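/- Consider $N$ agents and $H$ hypotheses $\Theta=\{1,\dots,H\}$ with true hypothesis $\theta_0$. Let $A=[a_{\ell k}]$ be a non-negative left-stochastic combination matrix (each column sums to $1$) of a strongly connected network; as is standard, the network is also aperiodic (the lengths of the closed walks along positive weights have greatest common divisor $1$; e.g. some $a_{kk}>0$). Let $\pi$ be the Perron eigenvector of $A$, $A\pi=\pi$, $\mathbb 1^\top\pi=1$, $\pi\succ0$. Agent $k$ observes data $\xi_{k,i}\in\mathcal X_k$, $i=1,2,\dots$, distributed with density $L_k(\cdot\mid\theta_0)$, where $L_k(\cdot\mid\theta)$, $\theta\in\Theta$, are the likelihoods of agent $k$ (probability densities with respect to a $\sigma$-finite measure). The data are i.i.d. over time and independent across agents. With step-size $\delta\in(0,1)$, the beliefs evolve by $$\psi_{k,i}(\theta)=\frac{\mu_{k,i-1}(\theta)^{1-\delta}L_k(\xi_{k,i}\mid\theta)^{\delta}}{\sum_{\theta'}\mu_{k,i-1}(\theta')^{1-\delta}L_k(\xi_{k,i}\mid\theta')^{\delta}},\qquad \mu_{k,i}(\theta)=\frac{\exp\{\sum_\ell a_{\ell k}\log\psi_{\ell,i}(\theta)\}}{\sum_{\theta'}\exp\{\sum_\ell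 a_{\ell k}\log\psi_{\ell,i}(\theta')\}}.$$ Let $x_{k,i}(\theta)=\log\frac{L_k(\xi_{k,i}\mid\theta_0)}{L_k(\xi_{k,i}\mid\theta)}$, $d_k(\theta)=\mathbb E[x_{k,i}(\theta)]$, $\rho_k(\theta,\theta')=\mathrm{Cov}(x_{k,i}(\theta),x_{k,i}(\theta'))$, and for $\theta,\theta'\neq\theta_0$ $$\mathsf m_{\rm ave}(\theta)=\sum_{\ell}\pi_\ell d_\ell(\theta),\qquad \mathsf C_{\rm ave}(\theta,\theta')=\sum_\ell\pi_\ell^2\rho_\ell(\theta,\theta').$$ Assume that the initial beliefs $\mu_{k,0}$ are strictly positive probability vectors; that for all $k$ and $\theta\ne\theta_0$ the Kullback–Leibler divergence of $L_k(\cdot\mid\theta_0)$ from $L_k(\cdot\mid\theta)$, which equals $d_k(\theta)$, is finite; that for each $\theta\neq\theta_0$ there is an agent $k$ with $d_k(\theta)>0$; and that all $x_{k,i}(\theta)$, $\theta\ne\theta_0$, have finite variance. Then, for each agent $k$: 1. for every $\delta\in(0,1)$ the inner series in $$\lambda_k^{(\delta)}(\theta)=\sum_{\ell=1}^N\delta\sum_{m=0}^\infty(1-\delta)^m[A^{m+1}]_{\ell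 k}\,x_{\ell,m+1}(\theta),\qquad\theta\ne\theta_0,$$ converge almost surely (absolutely), and the vector $\lambda_k^{(\delta)}=(\lambda_k^{(\delta)}(\theta))_{\theta\neq\theta_0}$ is the steady state of the log-belief ratios: $\big(\log\frac{\mu_{k,i}(\theta_0)}{\mu_{k,i}(\theta)}\big)_{\theta\ne\theta_0}$ converges in distribution to $\lambda_k^{(\delta)}$ as $i\to\infty$; 2. as $\delta\to0$, $\big(\lambda_k^{(\delta)}-\mathsf m_{\rm ave}\big)/\sqrt\delta$ converges in distribution to the zero-mean multivariate Gaussian with covariance matrix $\mathsf C_{\rm ave}/2$. -/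

import Mathlib

open MeasureTheory ProbabilityTheory Filter Topology

noncomputable section

namespace ASL

/-- Aperiodicity of the weighted directed graph whose edges are the positive entries of the
nonnegative matrix `A`: the only common divisor of the lengths of all closed walks is `1`.
For instance one self-loop `0 < A k k` is enough. -/
def IsAperiodic {N : ℕ} (A : Matrix (Fin N) (Fin N) ℝ) : Prop :=
  ∀ d : ℕ, (∀ (k : Fin N) (n : ℕ), 0 < n → 0 < (A ^ n) k k → d ∣ n) → d = 1

/-- The measure with density `f` with respect to the reference measure `ν`. -/
def law {X : Type*} [MeasurableSpace X] (ν : Measure X) (f : X → ℝ) : Measure X :=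
  ν.withDensity fun ξ => ENNReal.ofReal (f ξ)

/-- The log-likelihood ratio `log (L(ξ|θ₀) / L(ξ|θ))` as a function of the datum `ξ`. -/
def logLik {X : Type*} {H : ℕ} (L : Fin H → X → ℝ) (θ₀ θ : Fin H) (ξ : X) : ℝ :=
  Real.log (L θ₀ ξ / L θ ξ)

/-- The expected log-likelihood ratio `d(θ)`, the datum being distributed according to `θ₀`. -/
def meanLogLik {X : Type*} [MeasurableSpace X] {H : ℕ} (ν : Measure X) (L : Fin H → X → ℝ)
    (θ₀ θ : Fin H) : ℝ :=
  ∫ ξ, logLik L θ₀ θ ξ ∂(law ν (L θ₀))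

/-- The covariance `ρ(θ, θ')` of the log-likelihood ratios at `θ` and `θ'`, the datum being
distributed according to `θ₀`. -/
def covLogLik {X : Type*} [MeasurableSpace X] {H : ℕ} (ν : Measure X) (L : Fin H → X → ℝ)
    (θ₀ θ θ' : Fin H) : ℝ :=
  cov[logLik L θ₀ θ, logLik L θ₀ θ'; law ν (L θ₀)]

/-- The vector `m_ave = (∑ ℓ, π ℓ * d_ℓ(θ))`, `θ ≠ θ₀`. -/
def mAve {N H : ℕ} {X : Fin N → Type*} [∀ k, MeasurableSpace (X k)]
    (ν : ∀ k, Measure (X k)) (L : ∀ k, Fin H → X k → ℝ) (θ₀ : Fin H) (π : Fin N → ℝ) :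
    EuclideanSpace ℝ {θ : Fin H // θ ≠ θ₀} :=
  WithLp.toLp 2 fun θ => ∑ l, π l * meanLogLik (ν l) (L l) θ₀ θ.1

/-- The matrix `C_ave = (∑ ℓ, (π ℓ)² * ρ_ℓ(θ, θ'))`, `θ, θ' ≠ θ₀`. -/
def cAve {N H : ℕ} {X : Fin N → Type*} [∀ k, MeasurableSpace (X k)]
    (ν : ∀ k, Measure (X k)) (L : ∀ k, Fin H → X k → ℝ) (θ₀ : Fin H) (π : Fin N → ℝ) :
    Matrix {θ : Fin H // θ ≠ θ₀} {θ : Fin H // θ ≠ θ₀} ℝ :=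
  Matrix.of fun θ θ' => ∑ l, π l ^ 2 * covLogLik (ν l) (L l) θ₀ θ.1 θ'.1

/-- The adaptive Bayesian update: from the belief vector `μ` of an agent with likelihoods `L`
and its new datum `ξ` to the intermediate belief vector. -/
def adapt {X : Type*} {H : ℕ} (δ : ℝ) (L : Fin H → X → ℝ) (μ : Fin H → ℝ) (ξ : X)
    (θ : Fin H) : ℝ :=
  (μ θ ^ (1 - δ) * L θ ξ ^ δ) / ∑ θ' : Fin H, μ θ' ^ (1 - δ) * L θ' ξ ^ δ

/-- The combination step: agent `k` averages the logarithms of the intermediate beliefs `ψ ℓ`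
with the weights `A ℓ k` (which vanish when `ℓ` is not a neighbor of `k`) and normalizes. -/
def combine {N H : ℕ} (A : Matrix (Fin N) (Fin N) ℝ) (ψ : Fin N → Fin H → ℝ)
    (k : Fin N) (θ : Fin H) : ℝ :=
  Real.exp (∑ l, A l k * Real.log (ψ l θ)) /
    ∑ θ' : Fin H, Real.exp (∑ l, A l k * Real.log (ψ l θ'))

/-- The beliefs after `i` steps of the adaptive social learning algorithm with step-size `δ`,
started from `μ₀`; `obs k i` is the datum that agent `k` observes at time `i + 1`. -/
def belief {N H : ℕ} {X : Fin N → Type*} (A : Matrix (Fin N) (Fin N) ℝ)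
    (L : ∀ k, Fin H → X k → ℝ) (δ : ℝ) (μ₀ : Fin N → Fin H → ℝ) (obs : ∀ k, ℕ → X k) :
    ℕ → Fin N → Fin H → ℝ
  | 0 => μ₀
  | i + 1 => combine A fun l => adapt δ (L l) (belief A L δ μ₀ obs i l) (obs l i)

/-- The vector of log-belief ratios `log (μ_{k,i}(θ₀) / μ_{k,i}(θ))`, `θ ≠ θ₀`, of agent `k` at
time `i`. -/
def logBelief {N H : ℕ} {X : Fin N → Type*} (A : Matrix (Fin N) (Fin N) ℝ)
    (L : ∀ k, Fin H → X k → ℝ) (θ₀ : Fin H) (δ : ℝ) (μ₀ : Fin N → Fin H → ℝ)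
    (obs : ∀ k, ℕ → X k) (k : Fin N) (i : ℕ) : EuclideanSpace ℝ {θ : Fin H // θ ≠ θ₀} :=
  WithLp.toLp 2 fun θ =>
    Real.log (belief A L δ μ₀ obs i k θ₀ / belief A L δ μ₀ obs i k θ.1)

/-- The `m`-th term `(1-δ)^m [A^(m+1)]_{ℓk} x_{ℓ,m+1}(θ)` of the inner series that agent `ℓ`
contributes to the steady-state log-belief ratio of agent `k` at `θ`. -/
def steadyTerm {N H : ℕ} {X : Fin N → Type*} (A : Matrix (Fin N) (Fin N) ℝ)
    (L : ∀ k, Fin H → X k → ℝ) (θ₀ : Fin H) (δ : ℝ) (obs : ∀ k, ℕ → X k) (k : Fin N)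
    (θ : Fin H) (l : Fin N) (m : ℕ) : ℝ :=
  (1 - δ) ^ m * (A ^ (m + 1)) l k * logLik (L l) θ₀ θ (obs l m)

/-- The steady-state vector of log-belief ratios of agent `k`, as the series
`∑ ℓ, δ ∑ m, (1-δ)^m [A^(m+1)]_{ℓk} x_{ℓ,m+1}(θ)`, `θ ≠ θ₀`. -/
def steadyLogBelief {N H : ℕ} {X : Fin N → Type*} (A : Matrix (Fin N) (Fin N) ℝ)
    (L : ∀ k, Fin H → X k → ℝ) (θ₀ : Fin H) (δ : ℝ) (obs : ∀ k, ℕ → X k) (k : Fin N) :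
    EuclideanSpace ℝ {θ : Fin H // θ ≠ θ₀} :=
  WithLp.toLp 2 fun θ => ∑ l, δ * ∑' m, steadyTerm A L θ₀ δ obs k θ.1 l m

end ASL

end

/-! Taking logarithms of belief ratios removes both normalizations, so the algorithm becomes a
linear recursion. Its solution is a term carrying the initial beliefs, which decays like `(1-δ)^i`,
plus the data of age `m` weighted by `δ (1-δ)^m A^(m+1)` (`log_belief_div`). For fixed `δ`,
reversing the order of finitely many i.i.d. data preserves the law of this sum
(`identDistrib_sum_reverse`). In reversed order it is a partial sum of an almost surely convergent
series, whose limit is the steady state.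

For small `δ`, the entries of `A^(m+1)` approach `π` at a summable rate (`summable_abs_pow_sub`).
Replacing them by `π` changes the steady state by `δ` times a random quantity bounded independently
of `δ`, which is negligible after division by `√δ`. What remains is `√δ ∑ m, (1-δ)^m z_m` with the
i.i.d. centered vectors `z_m = ∑ ℓ, π ℓ (x_{ℓ,m+1} - d_ℓ)`. Its characteristic function is an
infinite product. With `s_m = √δ (1-δ)^m`, each factor is within `ε s_m²` of a Gaussian one, and `∑
s_m² = 1/(2-δ) ≤ 1`. So the total error is at most `ε`, and the covariance tends to half that of
`z_0`, which is `C_ave` by independence of the agents. -/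

namespace ASL

/-! ### Powers of irreducible aperiodic left-stochastic matrices -/

/-- All sufficiently high powers of an irreducible aperiodic matrix have positive diagonal. -/
theorem exists_forall_ge_pow_diag_pos {N : ℕ} {A : Matrix (Fin N) (Fin N) ℝ}
    (hA : A.IsIrreducible) (hper : IsAperiodic A) (k : Fin N) :
    ∃ n₀, ∀ n ≥ n₀, 0 < (A ^ n) k k := by
  have hpow : ∀ (m n : ℕ) (i j l : Fin N), 0 < (A ^ m) i j → 0 < (A ^ n) j l →
      0 < (A ^ (m + n)) i l := by
    intro m n i j l hij hjl
    rw [pow_add, Matrix.mul_apply]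
    refine lt_of_lt_of_le (mul_pos hij hjl) (Finset.single_le_sum
      (f := fun x => (A ^ m) i x * (A ^ n) x l) (fun x _ => ?_) (Finset.mem_univ j))
    exact mul_nonneg (Matrix.pow_apply_nonneg hA.nonneg m i x)
      (Matrix.pow_apply_nonneg hA.nonneg n x l)
  have hirr := (Matrix.isIrreducible_iff_exists_pow_pos hA.nonneg).1 hA
  set s : Set ℕ := {n | 0 < (A ^ n) k k} with hs
  -- Aperiodicity speaks of closed walks at all vertices. A closed walk of length `n` at `j` can be
  -- inserted into a loop `k → j → k`, so the gcd at `k` divides both `a + b` and `a + n + b`, hence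
  -- `n`.
  have hgcd : Nat.setGcd s = 1 := by
    refine hper _ fun j n _ hn => ?_
    obtain ⟨a, -, ha⟩ := hirr k j
    obtain ⟨b, -, hb⟩ := hirr j k
    have h1 : Nat.setGcd s ∣ a + b := Nat.setGcd_dvd_of_mem (hpow a b k j k ha hb)
    have h2 : Nat.setGcd s ∣ a + n + b :=
      Nat.setGcd_dvd_of_mem (hpow (a + n) b k j k (hpow a n k j j ha hn) hb)
    have h3 : a + n + b = a + b + n := by ring
    rw [h3] at h2
    exact (Nat.dvd_add_right h1).1 h2
  -- All large multiples of the gcd lie in the additive closure of `s`, and `s` is itself closed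
  -- under addition.
  obtain ⟨n₀, hn₀⟩ := Nat.exists_mem_closure_of_ge s
  refine ⟨n₀, fun n hn => ?_⟩
  have hmem := hn₀ n hn (by rw [hgcd]; exact one_dvd n)
  clear hn
  induction hmem using AddSubmonoid.closure_induction with
  | mem x hx => exact hx
  | zero => simp
  | add x y _ _ hx hy => exact hpow x y k k k hx hy

/-- An irreducible aperiodic matrix is primitive. -/
theorem isPrimitive_of_isAperiodic {N : ℕ} {A : Matrix (Fin N) (Fin N) ℝ}
    (hA : A.IsIrreducible) (hper : IsAperiodic A) : A.IsPrimitive := by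
  have hirr := (Matrix.isIrreducible_iff_exists_pow_pos hA.nonneg).1 hA
  choose a _ ha using hirr
  choose b hb using fun k => exists_forall_ge_pow_diag_pos hA hper k
  -- This exponent exceeds every `a i j + b j`: walk from `i` to `j`, then spend the remaining time
  -- on a closed walk at `j`.
  refine ⟨hA.nonneg, ∑ i, ∑ j, a i j + ∑ j, b j + 1, by omega, fun i j => ?_⟩
  have h1 : a i j ≤ ∑ i, ∑ j, a i j :=
    (Finset.single_le_sum (f := fun j => a i j) (fun _ _ => Nat.zero_le _)
      (Finset.mem_univ j)).trans
    (Finset.single_le_sum (f := fun i => ∑ j, a i j) (fun _ _ => Nat.zero_le _)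
      (Finset.mem_univ i))
  have h2 : b j ≤ ∑ j, b j :=
    Finset.single_le_sum (f := b) (fun _ _ => Nat.zero_le _) (Finset.mem_univ j)
  obtain ⟨c, hc⟩ : ∃ c, ∑ i, ∑ j, a i j + ∑ j, b j + 1 = a i j + (b j + c) :=
    ⟨∑ i, ∑ j, a i j + ∑ j, b j + 1 - a i j - b j, by omega⟩
  rw [hc, pow_add, Matrix.mul_apply]
  refine lt_of_lt_of_le (mul_pos (ha i j) (hb j (b j + c) (by omega))) (Finset.single_le_sum
    (f := fun x => (A ^ a i j) i x * (A ^ (b j + c)) x j) (fun x _ => ?_) (Finset.mem_univ j))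
  exact mul_nonneg (Matrix.pow_apply_nonneg hA.nonneg _ i x)
    (Matrix.pow_apply_nonneg hA.nonneg _ x j)

/-- The powers of a left-stochastic matrix are left-stochastic. -/
theorem sum_pow_apply {N : ℕ} {A : Matrix (Fin N) (Fin N) ℝ} (hA : ∀ k, ∑ l, A l k = 1) (n : ℕ)
    (k : Fin N) : ∑ l, (A ^ n) l k = 1 := by
  induction n generalizing k with
  | zero => simp [Matrix.one_apply]
  | succ n ih =>
    simp_rw [pow_succ, Matrix.mul_apply]
    rw [Finset.sum_comm]
    simp_rw [← Finset.sum_mul, ih, one_mul, hA]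

theorem pow_apply_le_one {N : ℕ} {A : Matrix (Fin N) (Fin N) ℝ} (hnn : ∀ i j, 0 ≤ A i j)
    (hA : ∀ k, ∑ l, A l k = 1) (n : ℕ) (l k : Fin N) : (A ^ n) l k ≤ 1 := by
  rw [← sum_pow_apply hA n k]
  exact Finset.single_le_sum (f := fun l => (A ^ n) l k)
    (fun l _ => Matrix.pow_apply_nonneg hnn n l k) (Finset.mem_univ l)

theorem pow_mulVec_eq {N : ℕ} {A : Matrix (Fin N) (Fin N) ℝ} {π : Fin N → ℝ}
    (hπ : A.mulVec π = π) (n : ℕ) : (A ^ n).mulVec π = π := by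
  induction n with
  | zero => simp
  | succ n ih => rw [pow_succ, ← Matrix.mulVec_mulVec, hπ, ih]

/-- Doeblin's contraction: a left-stochastic matrix with entries at least `ε` contracts the
`ℓ¹` norm of vectors with zero sum. -/
theorem sum_abs_mulVec_le {N : ℕ} {B : Matrix (Fin N) (Fin N) ℝ} {ε : ℝ}
    (hε : ∀ i j, ε ≤ B i j) (hB : ∀ k, ∑ l, B l k = 1) {v : Fin N → ℝ} (hv : ∑ i, v i = 0) :
    ∑ i, |B.mulVec v i| ≤ (1 - N * ε) * ∑ i, |v i| := by
  -- As `v` has zero sum, subtracting `ε` from all entries of `B` does not affect `B v`. The new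
  -- entries are nonnegative with column sums `1 - N ε`.
  have h1 : ∀ i, B.mulVec v i = ∑ j, (B i j - ε) * v j := by
    intro i
    simp_rw [sub_mul, Finset.sum_sub_distrib, ← Finset.mul_sum, hv]
    simp [Matrix.mulVec, dotProduct]
  calc ∑ i, |B.mulVec v i| ≤ ∑ i, ∑ j, (B i j - ε) * |v j| := by
        refine Finset.sum_le_sum fun i _ => ?_
        rw [h1]
        refine (Finset.abs_sum_le_sum_abs _ _).trans (Finset.sum_le_sum fun j _ => ?_)
        rw [abs_mul, abs_of_nonneg (sub_nonneg.2 (hε i j))]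
    _ = (1 - N * ε) * ∑ i, |v i| := by
        rw [Finset.sum_comm, Finset.mul_sum]
        refine Finset.sum_congr rfl fun j _ => ?_
        rw [← Finset.sum_mul, Finset.sum_sub_distrib, hB]
        simp

/-- The powers of a primitive left-stochastic matrix converge to the Perron vector at a
summable rate. -/
theorem summable_abs_pow_sub {N : ℕ} {A : Matrix (Fin N) (Fin N) ℝ} (hA : A.IsPrimitive)
    (hst : ∀ k, ∑ l, A l k = 1) {π : Fin N → ℝ} (hπ : A.mulVec π = π) (hsum : ∑ l, π l = 1)
    (l k : Fin N) : Summable fun m => |(A ^ (m + 1)) l k - π l| := by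
  obtain ⟨n₀, -, hpos⟩ := hA.exists_pos_pow
  obtain ⟨ε, hε, hεle⟩ : ∃ ε > 0, ∀ i j, ε ≤ (A ^ n₀) i j := by
    obtain ⟨p, -, hp⟩ := Finset.exists_min_image (Finset.univ : Finset (Fin N × Fin N))
      (fun p => (A ^ n₀) p.1 p.2) ⟨(k, k), Finset.mem_univ _⟩
    exact ⟨_, hpos p.1 p.2, fun i j => hp (i, j) (Finset.mem_univ _)⟩
  set u : ℕ → ℝ := fun n => ∑ i, |(A ^ n) i k - π i| with hu
  have hu0 : ∀ n, 0 ≤ u n := fun n => Finset.sum_nonneg fun _ _ => abs_nonneg _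
  set c : ℝ := 1 - N * ε with hc
  have hNpos : (0 : ℝ) < N := by
    have : 0 < N := k.pos
    exact_mod_cast this
  have hc1 : c < 1 := by have := mul_pos hNpos hε; linarith
  have hstep : ∀ n, u (n + n₀) ≤ c * u n := by
    intro n
    have key := sum_abs_mulVec_le (v := fun i => (A ^ n) i k - π i) hεle (sum_pow_apply hst n₀)
      (by rw [Finset.sum_sub_distrib, sum_pow_apply hst n k, hsum, sub_self])
    refine le_of_eq_of_le (Finset.sum_congr rfl fun i _ => ?_) key
    congr 1
    have h2 : (A ^ n₀).mulVec (fun i => (A ^ n) i k - π i)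
        = (A ^ n₀).mulVec (fun i => (A ^ n) i k) - (A ^ n₀).mulVec π := by
      rw [← Matrix.mulVec_sub]; rfl
    rw [h2, pow_mulVec_eq hπ, add_comm n, pow_add]
    rfl
  -- No explicit geometric rate is needed: the partial sums satisfy `S_M ≤ S_{n₀+M} ≤ S_{n₀} + c
  -- S_M`, so they are bounded by `S_{n₀} / (1 - c)`.
  have hsu : Summable u := by
    refine summable_of_sum_range_le (c := (∑ n ∈ Finset.range n₀, u n) / (1 - c)) hu0 fun M => ?_
    have hmono : ∑ n ∈ Finset.range M, u n ≤ ∑ n ∈ Finset.range (n₀ + M), u n :=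
      Finset.sum_le_sum_of_subset_of_nonneg (Finset.range_subset_range.2 (by omega))
        fun _ _ _ => hu0 _
    have hle : ∑ n ∈ Finset.range (n₀ + M), u n
        ≤ ∑ n ∈ Finset.range n₀, u n + c * ∑ n ∈ Finset.range M, u n := by
      rw [Finset.sum_range_add, Finset.mul_sum]
      gcongr with n
      rw [add_comm n₀ n]
      exact hstep n
    rw [le_div_iff₀ (by linarith)]
    linarith
  refine ((summable_nat_add_iff 1).2 hsu).of_nonneg_of_le (fun _ => abs_nonneg _) fun m => ?_
  exact Finset.single_le_sum (f := fun i => |(A ^ (m + 1)) i k - π i|)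
    (fun _ _ => abs_nonneg _) (Finset.mem_univ l)

/-! ### Asymptotic normality of exponentially weighted i.i.d. series -/

/-- A series of identically distributed integrable random vectors with absolutely summable
coefficients converges absolutely almost surely. -/
theorem ae_summable_norm_smul {Ω : Type*} [MeasurableSpace Ω] {P : Measure Ω}
    {E : Type*} [NormedAddCommGroup E] [NormedSpace ℝ E] [MeasurableSpace E] [BorelSpace E]
    {Y : ℕ → Ω → E} (hid : ∀ m, IdentDistrib (Y m) (Y 0) P P) (hY : ∀ m, Integrable (Y m) P)
    {c : ℕ → ℝ} (hc : Summable c) : ∀ᵐ ω ∂P, Summable fun m => ‖c m • Y m ω‖ := by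
  refine summable_norm_of_tsum_eLpNorm_ne_top (p := 1) le_rfl
    (f := fun m => c m • Y m) (fun m => (hY m).1.const_smul (c m)) ?_
  have h : ∀ m, eLpNorm (c m • Y m) 1 P = ‖c m‖ₑ * eLpNorm (Y 0) 1 P := fun m => by
    rw [eLpNorm_const_smul, (hid m).eLpNorm_eq]
  simp_rw [h]
  rw [ENNReal.tsum_mul_right]
  exact ENNReal.mul_ne_top (tsum_enorm_ne_top_iff_summable_norm.2 hc.norm)
    (memLp_one_iff_integrable.2 (hY 0)).eLpNorm_ne_top

/-- Exchange the factors one at a time; all others have norm at most `1`. The bound lets a sum of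
errors `ε s_m²` control a product of characteristic functions. -/
theorem norm_prod_sub_prod_le_sum {ι : Type*} (s : Finset ι) (f g : ι → ℂ)
    (hf : ∀ i, ‖f i‖ ≤ 1) (hg : ∀ i, ‖g i‖ ≤ 1) :
    ‖∏ i ∈ s, f i - ∏ i ∈ s, g i‖ ≤ ∑ i ∈ s, ‖f i - g i‖ := by
  classical
  induction s using Finset.induction with
  | empty => simp
  | insert a s ha ih =>
    rw [Finset.prod_insert ha, Finset.prod_insert ha, Finset.sum_insert ha]
    have h1 : f a * ∏ i ∈ s, f i - g a * ∏ i ∈ s, g i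
        = (f a - g a) * ∏ i ∈ s, f i + g a * (∏ i ∈ s, f i - ∏ i ∈ s, g i) := by ring
    have h2 : ‖∏ i ∈ s, f i‖ ≤ 1 := by
      rw [norm_prod]
      exact Finset.prod_le_one (fun _ _ => norm_nonneg _) fun i _ => hf i
    rw [h1]
    refine (norm_add_le _ _).trans (add_le_add ?_ ?_)
    · rw [norm_mul]
      exact mul_le_of_le_one_right (norm_nonneg _) h2
    · rw [norm_mul]
      exact (mul_le_of_le_one_left (norm_nonneg _) (hg a)).trans ih

/-- Second order expansion at `0` of the characteristic function of a centered random variable,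
compared with that of the Gaussian with the same variance. -/
theorem charFun_sub_exp_isLittleO {Ω : Type*} [MeasurableSpace Ω] {P : Measure Ω}
    [IsProbabilityMeasure P] {X : Ω → ℝ} (hX : MemLp X 2 P) (h0 : ∫ ω, X ω ∂P = 0) :
    (fun s : ℝ => charFun (P.map X) s - ((Real.exp (-(Var[X; P] * s ^ 2 / 2)) : ℝ) : ℂ))
      =o[𝓝 0] fun s : ℝ => s ^ 2 := by
  have hXm : AEMeasurable X P := hX.1.aemeasurable
  have : IsProbabilityMeasure (P.map X) := Measure.isProbabilityMeasure_map hXm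
  have hid : MemLp id 2 (P.map X) := (memLp_map_measure_iff (by fun_prop) hXm).2 hX
  have hT : (fun s : ℝ => charFun (P.map X) s - (1 - ((Var[X; P] * s ^ 2 / 2 : ℝ) : ℂ)))
      =o[𝓝 0] fun s : ℝ => s ^ 2 := by
    have h1 := taylor_isLittleO_univ (x₀ := 0) (n := 2)
      (contDiff_charFun (μ := P.map X) (n := 2) hid)
    refine (h1.congr_left fun s => ?_).congr_right fun s => by rw [sub_zero]
    rw [taylorWithinEval_charFun_two_zero hXm hid, h0, variance_of_integral_eq_zero hXm h0]
    push_cast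
    simp only [Pi.pow_apply]
    ring
  have hE : (fun s : ℝ => ((1 - Var[X; P] * s ^ 2 / 2
      - Real.exp (-(Var[X; P] * s ^ 2 / 2)) : ℝ) : ℂ)) =o[𝓝 0] fun s : ℝ => s ^ 2 := by
    rw [← Asymptotics.isLittleO_norm_left]
    simp_rw [Complex.norm_real]
    rw [Asymptotics.isLittleO_norm_left]
    -- The Gaussian has the same second order expansion, since `exp x - 1 - x = o(x)` at `x = -Var
    -- s² / 2 = O(s²)`.
    have h2 : (fun x : ℝ => Real.exp x - 1 - x) =o[𝓝 0] fun x => x := by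
      have := (Real.hasDerivAt_exp 0).isLittleO
      simpa using this
    have h3 : Tendsto (fun s : ℝ => -(Var[X; P] * s ^ 2 / 2)) (𝓝 0) (𝓝 0) := by
      have : Continuous fun s : ℝ => -(Var[X; P] * s ^ 2 / 2) := by fun_prop
      simpa using this.tendsto 0
    have h4 := (h2.comp_tendsto h3).neg_left
    have h5 : (fun s : ℝ => -(Var[X; P] * s ^ 2 / 2)) =O[𝓝 0] fun s : ℝ => s ^ 2 := by
      refine Asymptotics.IsBigO.of_bound (Var[X; P] / 2) (Eventually.of_forall fun s => ?_)
      have := variance_nonneg X P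
      rw [norm_neg, Real.norm_eq_abs, Real.norm_eq_abs, abs_of_nonneg (by positivity),
        abs_of_nonneg (by positivity)]
      linarith
    refine (h4.trans_isBigO h5).congr_left fun s => ?_
    simp only [Function.comp]
    ring
  refine (hT.add hE).congr_left fun s => ?_
  push_cast
  ring

/-- Along a ray, the characteristic function of a vector is that of a scalar projection, so the
one-dimensional expansion suffices. -/
theorem charFun_map_smul_eq {Ω : Type*} [MeasurableSpace Ω] {P : Measure Ω}
    {E : Type*} [NormedAddCommGroup E] [InnerProductSpace ℝ E] [SecondCountableTopology E]
    [MeasurableSpace E] [BorelSpace E] {Z : Ω → E} (hZ : AEMeasurable Z P) (s : ℝ) (t : E) :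
    charFun (P.map Z) (s • t) = charFun (P.map fun ω => inner ℝ (Z ω) t) s := by
  rw [charFun_apply, charFun_apply_real, integral_map hZ (by fun_prop),
    integral_map (by fun_prop) (by fun_prop)]
  simp [inner_smul_right]

/-- Quantitative form of the asymptotic normality of exponentially weighted sums of i.i.d.
centered random vectors. -/
theorem exists_norm_charFun_tsum_sub_exp_le {Ω : Type*} [MeasurableSpace Ω] {P : Measure Ω}
    [IsProbabilityMeasure P] {E : Type*} [NormedAddCommGroup E] [InnerProductSpace ℝ E]
    [FiniteDimensional ℝ E] [MeasurableSpace E] [BorelSpace E] {z : ℕ → Ω → E}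
    (hind : iIndepFun z P) (hid : ∀ m, IdentDistrib (z m) (z 0) P P) (hz : MemLp (z 0) 2 P)
    (h0 : ∫ ω, z 0 ω ∂P = 0) (t : E) {ε : ℝ} (hε : 0 < ε) :
    ∃ η > 0, ∀ δ ∈ Set.Ioo (0 : ℝ) 1, δ < η →
      ‖charFun (P.map fun ω => √δ • ∑' m, (1 - δ) ^ m • z m ω) t
        - ((Real.exp (-(Var[fun ω => inner ℝ (z 0 ω) t; P] / 2 * (2 - δ)⁻¹)) : ℝ) : ℂ)‖ ≤ ε := by
  have hcomp : CompleteSpace E := FiniteDimensional.complete ℝ E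
  have hzm : ∀ m, AEMeasurable (z m) P := fun m => (hid m).aemeasurable_fst
  have hzint : ∀ m, Integrable (z m) P := fun m =>
    (hid m).integrable_iff.2 (hz.integrable (by norm_num))
  set X : Ω → ℝ := fun ω => inner ℝ (z 0 ω) t with hX
  have hXL : MemLp X 2 P := by
    simpa only [hX, real_inner_comm] using hz.const_inner t
  have hX0 : ∫ ω, X ω ∂P = 0 := by
    have := integral_inner (𝕜 := ℝ) (hzint 0) t
    simp only [hX]
    simp_rw [real_inner_comm t]
    rw [this, h0, inner_zero_right]
  obtain ⟨r, hr, hball⟩ := Metric.eventually_nhds_iff.1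
    ((charFun_sub_exp_isLittleO hXL hX0).bound hε)
  -- `δ < r²` puts every `s m ≤ √δ` inside the radius `r` where the expansion holds with error `ε
  -- s²`.
  refine ⟨r ^ 2, by positivity, fun δ hδ hδr => ?_⟩
  have hq0 : 0 ≤ 1 - δ := by linarith [hδ.2]
  have hq1 : 1 - δ < 1 := by linarith [hδ.1]
  set s : ℕ → ℝ := fun m => √δ * (1 - δ) ^ m with hs
  have hs0 : ∀ m, 0 ≤ s m := fun m => mul_nonneg (Real.sqrt_nonneg _) (pow_nonneg hq0 m)
  have hsr : ∀ m, s m < r := fun m =>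
    lt_of_le_of_lt (mul_le_of_le_one_right (Real.sqrt_nonneg _) (pow_le_one₀ hq0 hq1.le))
      ((Real.sqrt_lt' hr).2 hδr)
  have hsq : HasSum (fun m => s m ^ 2) (2 - δ)⁻¹ := by
    have h1 : ∀ m, s m ^ 2 = δ * ((1 - δ) ^ 2) ^ m := fun m => by
      rw [hs]; simp only
      rw [mul_pow, Real.sq_sqrt hδ.1.le, ← pow_mul, ← pow_mul, mul_comm m 2]
    have h2 := (hasSum_geometric_of_lt_one (sq_nonneg (1 - δ))
      (by nlinarith : (1 - δ) ^ 2 < 1)).mul_left δ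
    have h3 : δ * (1 - (1 - δ) ^ 2)⁻¹ = (2 - δ)⁻¹ := by
      have ha : δ ≠ 0 := hδ.1.ne'
      have hb : 2 - δ ≠ 0 := by linarith [hδ.2]
      have hc : 1 - (1 - δ) ^ 2 = δ * (2 - δ) := by ring
      rw [hc]; field_simp
    rw [h3] at h2
    exact h2.congr_fun h1
  have hsle : ∀ n, ∑ m ∈ Finset.range n, s m ^ 2 ≤ 1 := fun n =>
    (sum_le_hasSum _ (fun m _ => sq_nonneg (s m)) hsq).trans
      (inv_le_one_of_one_le₀ (by linarith [hδ.2]))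
  set φ : ℝ → ℂ := charFun (P.map X) with hφ
  set g : ℝ → ℂ := fun x => ((Real.exp (-(Var[X; P] * x ^ 2 / 2)) : ℝ) : ℂ) with hg
  have hXp : IsProbabilityMeasure (P.map X) := Measure.isProbabilityMeasure_map hXL.1.aemeasurable
  have hbound : ∀ n, ‖∏ m ∈ Finset.range n, φ (s m) - ∏ m ∈ Finset.range n, g (s m)‖ ≤ ε := by
    intro n
    refine (norm_prod_sub_prod_le_sum _ _ _ (fun m => norm_charFun_le_one _) fun m => ?_).trans ?_
    · rw [hg, Complex.norm_real, Real.norm_eq_abs, Real.abs_exp, Real.exp_le_one_iff]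
      have := variance_nonneg X P
      have : 0 ≤ Var[X; P] * s m ^ 2 / 2 := by positivity
      linarith
    · calc ∑ m ∈ Finset.range n, ‖φ (s m) - g (s m)‖
          ≤ ∑ m ∈ Finset.range n, ε * s m ^ 2 := by
            refine Finset.sum_le_sum fun m _ => ?_
            have := hball (y := s m) (by
              rw [Real.dist_eq, sub_zero, abs_of_nonneg (hs0 m)]; exact hsr m)
            rwa [Real.norm_eq_abs, abs_of_nonneg (sq_nonneg (s m))] at this
        _ ≤ ε := by
            rw [← Finset.mul_sum]
            exact mul_le_of_le_one_right hε.le (hsle n)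
  have hglim : Tendsto (fun n => ∏ m ∈ Finset.range n, g (s m)) atTop
      (𝓝 ((Real.exp (-(Var[X; P] / 2 * (2 - δ)⁻¹)) : ℝ) : ℂ)) := by
    have h1 : ∀ n, ∏ m ∈ Finset.range n, g (s m)
        = ((Real.exp (-(Var[X; P] / 2 * ∑ m ∈ Finset.range n, s m ^ 2)) : ℝ) : ℂ) := fun n => by
      rw [hg, ← Complex.ofReal_prod, ← Real.exp_sum, Finset.mul_sum, ← Finset.sum_neg_distrib]
      congr 3
      ext m
      ring
    simp_rw [h1]
    exact (Complex.continuous_ofReal.tendsto _).comp ((Real.continuous_exp.tendsto _).comp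
      ((hsq.tendsto_sum_nat.const_mul _).neg))
  have hφlim : Tendsto (fun n => ∏ m ∈ Finset.range n, φ (s m)) atTop
      (𝓝 (charFun (P.map fun ω => √δ • ∑' m, (1 - δ) ^ m • z m ω) t)) := by
    have h1 : ∀ n, ∏ m ∈ Finset.range n, φ (s m)
        = charFun (P.map fun ω => ∑ m ∈ Finset.range n, s m • z m ω) t := fun n => by
      have hi : iIndepFun (fun m ω => s m • z m ω) P :=
        hind.comp (fun m x => s m • x) fun m => by fun_prop
      rw [(hi.restrict _).charFun_map_fun_finsetSum_eq_prod (X := fun m ω => s m • z m ω)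
        fun m _ => (hzm m).const_smul (s m), Finset.prod_apply]
      refine Finset.prod_congr rfl fun m _ => ?_
      rw [charFun_map_smul_comp (hzm m), (hid m).map_eq, charFun_map_smul_eq (hzm 0)]
    simp_rw [h1]
    have hmS : ∀ n, AEMeasurable (fun ω => ∑ m ∈ Finset.range n, s m • z m ω) P := fun n =>
      Finset.aemeasurable_fun_sum _ fun m _ => (hzm m).const_smul (s m)
    have hmT : AEMeasurable (fun ω => √δ • ∑' m, (1 - δ) ^ m • z m ω) P :=
      (AEMeasurable.tsum fun m => (hzm m).const_smul _).const_smul _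
    have hlim := tendstoInDistribution_of_ae_tendsto (l := atTop) hmS hmT (by
      filter_upwards [ae_summable_norm_smul hid hzint (summable_geometric_of_lt_one hq0 hq1)]
        with ω hω
      have h2 := hω.of_norm.hasSum.const_smul (√δ)
      simp_rw [smul_smul] at h2
      exact h2.tendsto_sum_nat)
    exact ProbabilityMeasure.tendsto_iff_tendsto_charFun.1 hlim.tendsto t
  -- The bound `ε` is uniform in the number of factors, so it survives the passage to the infinite
  -- series.
  exact le_of_tendsto (hφlim.sub hglim).norm (Eventually.of_forall hbound)

/-- Exponentially weighted sums of i.i.d. centered random vectors are asymptotically normal as the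
step-size tends to `0`. -/
theorem tendstoInDistribution_sqrt_smul_tsum {Ω : Type*} [MeasurableSpace Ω] {P : Measure Ω}
    [IsProbabilityMeasure P] {E : Type*} [NormedAddCommGroup E] [InnerProductSpace ℝ E]
    [FiniteDimensional ℝ E] [MeasurableSpace E] [BorelSpace E] {z : ℕ → Ω → E}
    (hind : iIndepFun z P) (hid : ∀ m, IdentDistrib (z m) (z 0) P P) (hz : MemLp (z 0) 2 P)
    (h0 : ∫ ω, z 0 ω ∂P = 0) {G : Measure E} [IsProbabilityMeasure G]
    (hG : ∀ t, charFun G t =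
      ((Real.exp (-(Var[fun ω => inner ℝ (z 0 ω) t; P] / 4)) : ℝ) : ℂ))
    {δ : ℕ → ℝ} (hδ : ∀ n, δ n ∈ Set.Ioo (0 : ℝ) 1) (hδ0 : Tendsto δ atTop (𝓝 0)) :
    TendstoInDistribution (fun n ω => √(δ n) • ∑' m, (1 - δ n) ^ m • z m ω) atTop id
      (fun _ => P) G where
  forall_aemeasurable n :=
    (AEMeasurable.tsum fun m => ((hid m).aemeasurable_fst).const_smul _).const_smul _
  aemeasurable_limit := aemeasurable_id
  tendsto := by
    refine ProbabilityMeasure.tendsto_iff_tendsto_charFun.2 fun t => ?_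
    simp only [ProbabilityMeasure.coe_mk, Measure.map_id]
    rw [hG]
    set v := Var[fun ω => inner ℝ (z 0 ω) t; P]
    have h1 : Tendsto (fun n => ((Real.exp (-(v / 2 * (2 - δ n)⁻¹)) : ℝ) : ℂ)) atTop
        (𝓝 ((Real.exp (-(v / 4)) : ℝ) : ℂ)) := by
      refine (Complex.continuous_ofReal.tendsto _).comp ((Real.continuous_exp.tendsto _).comp ?_)
      -- The `4` is the `2` of the Gaussian exponent times the limit `2` of `2 - δ`.
      have h2 : v / 4 = v / 2 * (2 - 0)⁻¹ := by ring
      rw [h2]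
      exact (((tendsto_const_nhds.sub hδ0).inv₀ (by norm_num)).const_mul _).neg
    rw [← tendsto_sub_nhds_zero_iff] at h1 ⊢
    have h3 : Tendsto (fun n =>
        charFun (P.map fun ω => √(δ n) • ∑' m, (1 - δ n) ^ m • z m ω) t
          - ((Real.exp (-(v / 2 * (2 - δ n)⁻¹)) : ℝ) : ℂ)) atTop (𝓝 0) := by
      rw [Metric.tendsto_nhds]
      intro ε hε
      obtain ⟨η, hη, H⟩ := exists_norm_charFun_tsum_sub_exp_le hind hid hz h0 t (half_pos hε)
      filter_upwards [hδ0.eventually_lt_const hη] with n hn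
      rw [dist_zero_right]
      exact (H (δ n) (hδ n) hn).trans_lt (half_lt_self hε)
    simpa using h3.add h1

/-! ### The log-belief recursion and its closed form -/

theorem combine_pos {N H : ℕ} (A : Matrix (Fin N) (Fin N) ℝ) (ψ : Fin N → Fin H → ℝ)
    (k : Fin N) (θ : Fin H) : 0 < combine A ψ k θ :=
  div_pos (Real.exp_pos _) (Finset.sum_pos (fun _ _ => Real.exp_pos _) ⟨θ, Finset.mem_univ θ⟩)

theorem log_combine_div {N H : ℕ} (A : Matrix (Fin N) (Fin N) ℝ) (ψ : Fin N → Fin H → ℝ)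
    (k : Fin N) (θ₀ θ : Fin H) :
    Real.log (combine A ψ k θ₀ / combine A ψ k θ)
      = ∑ l, A l k * (Real.log (ψ l θ₀) - Real.log (ψ l θ)) := by
  have hS : (∑ θ' : Fin H, Real.exp (∑ l, A l k * Real.log (ψ l θ'))) ≠ 0 :=
    (Finset.sum_pos (fun _ _ => Real.exp_pos _) ⟨θ, Finset.mem_univ θ⟩).ne'
  rw [combine, combine, div_div_div_cancel_right₀ hS, ← Real.exp_sub, Real.log_exp,
    ← Finset.sum_sub_distrib]
  simp_rw [mul_sub]

/-- The normalizer is common to all hypotheses and cancels. Positivity of the likelihoods matters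
because `Real.log 0 = 0` would break the linearity. -/
theorem log_adapt_sub {X : Type*} {H : ℕ} {δ : ℝ} {L : Fin H → X → ℝ} {μ : Fin H → ℝ} {ξ : X}
    (hμ : ∀ θ, 0 < μ θ) (hL : ∀ θ, 0 < L θ ξ) (θ₀ θ : Fin H) :
    Real.log (adapt δ L μ ξ θ₀) - Real.log (adapt δ L μ ξ θ)
      = (1 - δ) * Real.log (μ θ₀ / μ θ) + δ * logLik L θ₀ θ ξ := by
  have hp : ∀ θ, 0 < μ θ ^ (1 - δ) * L θ ξ ^ δ := fun θ =>
    mul_pos (Real.rpow_pos_of_pos (hμ θ) _) (Real.rpow_pos_of_pos (hL θ) _)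
  have hS : 0 < ∑ θ' : Fin H, μ θ' ^ (1 - δ) * L θ' ξ ^ δ :=
    Finset.sum_pos (fun θ _ => hp θ) ⟨θ, Finset.mem_univ θ⟩
  have h : ∀ θ, Real.log (adapt δ L μ ξ θ) = (1 - δ) * Real.log (μ θ) + δ * Real.log (L θ ξ)
      - Real.log (∑ θ' : Fin H, μ θ' ^ (1 - δ) * L θ' ξ ^ δ) := fun θ => by
    rw [adapt, Real.log_div (hp θ).ne' hS.ne',
      Real.log_mul (Real.rpow_pos_of_pos (hμ θ) _).ne' (Real.rpow_pos_of_pos (hL θ) _).ne',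
      Real.log_rpow (hμ θ), Real.log_rpow (hL θ)]
  rw [h, h, logLik, Real.log_div (hμ _).ne' (hμ _).ne', Real.log_div (hL _).ne' (hL _).ne']
  ring

theorem belief_pos {N H : ℕ} {X : Fin N → Type*} (A : Matrix (Fin N) (Fin N) ℝ)
    (L : ∀ k, Fin H → X k → ℝ) (δ : ℝ) {μ₀ : Fin N → Fin H → ℝ} (hμ₀ : ∀ k θ, 0 < μ₀ k θ)
    (obs : ∀ k, ℕ → X k) (i : ℕ) (k : Fin N) (θ : Fin H) : 0 < belief A L δ μ₀ obs i k θ := by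
  cases i with
  | zero => exact hμ₀ k θ
  | succ i => exact combine_pos _ _ _ _

/-- Closed form of the log-belief ratios when the observed data have positive likelihoods. -/
theorem log_belief_div {N H : ℕ} {X : Fin N → Type*} (A : Matrix (Fin N) (Fin N) ℝ)
    (L : ∀ k, Fin H → X k → ℝ) (δ : ℝ) {μ₀ : Fin N → Fin H → ℝ} (hμ₀ : ∀ k θ, 0 < μ₀ k θ)
    (obs : ∀ k, ℕ → X k) (hL : ∀ k m θ, 0 < L k θ (obs k m)) (θ₀ θ : Fin H) (i : ℕ)
    (k : Fin N) :
    Real.log (belief A L δ μ₀ obs i k θ₀ / belief A L δ μ₀ obs i k θ)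
      = (1 - δ) ^ i * ∑ l, (A ^ i) l k * Real.log (μ₀ l θ₀ / μ₀ l θ)
        + ∑ m ∈ Finset.range i, ∑ l,
          δ * (1 - δ) ^ m * (A ^ (m + 1)) l k * logLik (L l) θ₀ θ (obs l (i - 1 - m)) := by
  induction i generalizing k with
  | zero => simp [belief, Matrix.one_apply]
  | succ i ih =>
    rw [belief, log_combine_div]
    have hstep : ∀ j, Real.log (adapt δ (L j) (belief A L δ μ₀ obs i j) (obs j i) θ₀)
        - Real.log (adapt δ (L j) (belief A L δ μ₀ obs i j) (obs j i) θ)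
        = _ := fun j => log_adapt_sub (fun θ => belief_pos A L δ hμ₀ obs i j θ)
          (fun θ => hL j i θ) θ₀ θ
    simp_rw [hstep, ih]
    have hpow : ∀ (n : ℕ) (c : Fin N → ℝ), ∑ j, A j k * ∑ l, (A ^ n) l j * c l
        = ∑ l, (A ^ (n + 1)) l k * c l := by
      intro n c
      simp_rw [Finset.mul_sum]
      rw [Finset.sum_comm]
      refine Finset.sum_congr rfl fun l _ => ?_
      rw [pow_succ, Matrix.mul_apply, Finset.sum_mul]
      exact Finset.sum_congr rfl fun j _ => by ring
    -- The peeled term `m = 0` is the newest datum; every older datum gains one factor `1 - δ` and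
    -- one factor `A`.
    rw [Finset.sum_range_succ']
    have h1 : ∑ l, δ * (1 - δ) ^ 0 * (A ^ (0 + 1)) l k * logLik (L l) θ₀ θ (obs l (i + 1 - 1 - 0))
        = ∑ j, A j k * (δ * logLik (L j) θ₀ θ (obs j i)) := by
      simp
      exact Finset.sum_congr rfl fun j _ => by ring
    have h2 : (1 - δ) ^ (i + 1) * ∑ l, (A ^ (i + 1)) l k * Real.log (μ₀ l θ₀ / μ₀ l θ)
        = ∑ j, A j k * ((1 - δ) *
          ((1 - δ) ^ i * ∑ l, (A ^ i) l j * Real.log (μ₀ l θ₀ / μ₀ l θ))) := by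
      rw [← hpow, Finset.mul_sum]
      exact Finset.sum_congr rfl fun j _ => by ring
    have h3 : ∑ m ∈ Finset.range i, ∑ l, δ * (1 - δ) ^ (m + 1) * (A ^ (m + 1 + 1)) l k
          * logLik (L l) θ₀ θ (obs l (i + 1 - 1 - (m + 1)))
        = ∑ j, A j k * ((1 - δ) * ∑ m ∈ Finset.range i, ∑ l,
          δ * (1 - δ) ^ m * (A ^ (m + 1)) l j * logLik (L l) θ₀ θ (obs l (i - 1 - m))) := by
      simp_rw [Finset.mul_sum (Finset.range i)]
      conv_rhs => rw [Finset.sum_comm]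
      refine Finset.sum_congr rfl fun m _ => ?_
      have h4 : i + 1 - 1 - (m + 1) = i - 1 - m := by omega
      rw [h4]
      calc _ = δ * (1 - δ) ^ (m + 1) * ∑ l, (A ^ (m + 1 + 1)) l k
            * logLik (L l) θ₀ θ (obs l (i - 1 - m)) := by
            rw [Finset.mul_sum]; exact Finset.sum_congr rfl fun l _ => by ring
        _ = _ := by
            rw [← hpow, Finset.mul_sum]
            refine Finset.sum_congr rfl fun j _ => ?_
            simp_rw [Finset.mul_sum]
            exact Finset.sum_congr rfl fun l _ => by ring
    rw [h1, h2, h3, ← Finset.sum_add_distrib, ← Finset.sum_add_distrib]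
    exact Finset.sum_congr rfl fun j _ => by ring

/-- The vector of log-likelihood ratios `log (L(ξ|θ₀) / L(ξ|θ))`, `θ ≠ θ₀`. -/
noncomputable def logLikVec {X : Type*} {H : ℕ} (L : Fin H → X → ℝ) (θ₀ : Fin H) (ξ : X) :
    EuclideanSpace ℝ {θ : Fin H // θ ≠ θ₀} :=
  WithLp.toLp 2 fun θ => logLik L θ₀ θ.1 ξ

theorem measurable_logLik {X : Type*} [MeasurableSpace X] {H : ℕ} {L : Fin H → X → ℝ}
    (hL : ∀ θ, Measurable (L θ)) (θ₀ θ : Fin H) : Measurable (logLik L θ₀ θ) :=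
  Real.measurable_log.comp ((hL θ₀).div (hL θ))

theorem measurable_logLikVec {X : Type*} [MeasurableSpace X] {H : ℕ} {L : Fin H → X → ℝ}
    (hL : ∀ θ, Measurable (L θ)) (θ₀ : Fin H) : Measurable (logLikVec L θ₀) :=
  (WithLp.measurable_toLp 2 _).comp (measurable_pi_lambda _ fun θ => measurable_logLik hL θ₀ θ.1)

theorem logBelief_eq {N H : ℕ} {X : Fin N → Type*} (A : Matrix (Fin N) (Fin N) ℝ)
    (L : ∀ k, Fin H → X k → ℝ) (δ : ℝ) {μ₀ : Fin N → Fin H → ℝ} (hμ₀ : ∀ k θ, 0 < μ₀ k θ)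
    (obs : ∀ k, ℕ → X k) (hL : ∀ k m θ, 0 < L k θ (obs k m)) (θ₀ : Fin H) (i : ℕ)
    (k : Fin N) :
    logBelief A L θ₀ δ μ₀ obs k i
      = (1 - δ) ^ i • ∑ l, (A ^ i) l k •
          WithLp.toLp 2 (fun θ : {θ : Fin H // θ ≠ θ₀} => Real.log (μ₀ l θ₀ / μ₀ l θ.1))
        + ∑ m ∈ Finset.range i, ∑ l,
          (δ * (1 - δ) ^ m * (A ^ (m + 1)) l k) • logLikVec (L l) θ₀ (obs l (i - 1 - m)) := by
  ext θ
  simp [logBelief, logLikVec, log_belief_div A L δ hμ₀ obs hL]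

/-! ### Time reversal and convergence of laws -/

/-- Time reversal: reversing the order of finitely many i.i.d. data does not change the law of an
additive functional. -/
theorem identDistrib_sum_reverse {Ω S E : Type*} [MeasurableSpace Ω] {P : Measure Ω}
    [MeasurableSpace S] [MeasurableSpace E] [AddCommMonoid E] [MeasurableAdd₂ E]
    {V : ℕ → Ω → S} (hind : iIndepFun V P) (hid : ∀ m, IdentDistrib (V m) (V 0) P P)
    {f : ℕ → S → E} (hf : ∀ m, Measurable (f m)) (n : ℕ) :
    IdentDistrib (fun ω => ∑ m ∈ Finset.range n, f m (V (n - 1 - m) ω))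
      (fun ω => ∑ m ∈ Finset.range n, f m (V m ω)) P P := by
  have h1 : iIndepFun (fun i : Fin n => V (n - 1 - i)) P :=
    hind.precomp (g := fun i : Fin n => n - 1 - (i : ℕ)) fun i j hij => by
      have := i.2; have := j.2
      simp only at hij
      ext; omega
  have h2 : iIndepFun (fun i : Fin n => V i) P := hind.precomp Fin.val_injective
  have h3 := IdentDistrib.pi (fun i : Fin n => (hid (n - 1 - i)).trans (hid i).symm) h1 h2
  simp_rw [Finset.sum_range]
  exact h3.comp (u := fun v : Fin n → S => ∑ i : Fin n, f i (v i))
    (Finset.measurable_fun_sum _ fun i _ => (hf i).comp (measurable_pi_apply i))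

/-- Convergence in distribution depends only on the laws of the random variables. -/
theorem tendstoInDistribution_congr_identDistrib {Ω Ω' E ι : Type*} [MeasurableSpace Ω]
    {P : Measure Ω} [IsProbabilityMeasure P] [MeasurableSpace Ω'] {P' : Measure Ω'}
    [IsProbabilityMeasure P'] [TopologicalSpace E] [MeasurableSpace E] [OpensMeasurableSpace E]
    {l : Filter ι} {X Y : ι → Ω → E} {Z : Ω' → E}
    (h : TendstoInDistribution X l Z (fun _ => P) P') (hXY : ∀ i, IdentDistrib (Y i) (X i) P P) :
    TendstoInDistribution Y l Z (fun _ => P) P' where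
  forall_aemeasurable i := (hXY i).aemeasurable_fst
  aemeasurable_limit := h.aemeasurable_limit
  tendsto := by
    refine h.tendsto.congr fun i => ?_
    exact Subtype.ext (hXY i).map_eq.symm

/-! ### Moments of the log-likelihood ratios and the Gaussian limit -/

/-- A density is positive almost everywhere for its law. -/
theorem ae_law_pos {X : Type*} [MeasurableSpace X] (ν : Measure X) {f : X → ℝ}
    (hf : Measurable f) : ∀ᵐ x ∂(law ν f), 0 < f x := by
  rw [law, ae_withDensity_iff hf.ennreal_ofReal]
  refine Eventually.of_forall fun x hx => ?_
  by_contra h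
  exact hx (ENNReal.ofReal_of_nonpos (not_lt.1 h))

theorem memLp_logLikVec {X : Type*} [MeasurableSpace X] {H : ℕ}
    {L : Fin H → X → ℝ} {θ₀ : Fin H} {μ : Measure X}
    (h : ∀ θ, θ ≠ θ₀ → MemLp (logLik L θ₀ θ) 2 μ) : MemLp (logLikVec L θ₀) 2 μ :=
  memLp_piLp_iff.2 fun θ => h θ.1 θ.2

theorem integral_logLikVec {X : Type*} [MeasurableSpace X] {ν : Measure X} {H : ℕ}
    {L : Fin H → X → ℝ} {θ₀ : Fin H} [IsProbabilityMeasure (law ν (L θ₀))]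
    (h : ∀ θ, θ ≠ θ₀ → MemLp (logLik L θ₀ θ) 2 (law ν (L θ₀))) :
    ∫ x, logLikVec L θ₀ x ∂(law ν (L θ₀))
      = WithLp.toLp 2 fun θ : {θ : Fin H // θ ≠ θ₀} => meanLogLik ν L θ₀ θ.1 := by
  ext θ
  rw [eval_integral_piLp fun θ => (h θ.1 θ.2).integrable (by norm_num)]
  rfl

theorem variance_inner_logLikVec {X : Type*} [MeasurableSpace X] {ν : Measure X} {H : ℕ}
    {L : Fin H → X → ℝ} {θ₀ : Fin H} [IsProbabilityMeasure (law ν (L θ₀))]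
    (h : ∀ θ, θ ≠ θ₀ → MemLp (logLik L θ₀ θ) 2 (law ν (L θ₀)))
    (t : EuclideanSpace ℝ {θ : Fin H // θ ≠ θ₀}) :
    Var[fun x => inner ℝ (logLikVec L θ₀ x) t; law ν (L θ₀)]
      = ∑ θ, ∑ θ', t θ * t θ' * covLogLik ν L θ₀ θ.1 θ'.1 := by
  have h1 : (fun x => inner ℝ (logLikVec L θ₀ x) t)
      = fun x => ∑ θ : {θ : Fin H // θ ≠ θ₀}, t θ * logLik L θ₀ θ.1 x := by
    ext x
    simp [PiLp.inner_apply, logLikVec]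
  have h2 : ∀ θ : {θ : Fin H // θ ≠ θ₀},
      MemLp (fun x => t θ * logLik L θ₀ θ.1 x) 2 (law ν (L θ₀)) := fun θ =>
    (h θ.1 θ.2).const_mul _
  rw [h1, ← covariance_self (memLp_finsetSum _ fun θ _ => h2 θ).1.aemeasurable,
    covariance_fun_sum_fun_sum h2 h2]
  refine Finset.sum_congr rfl fun θ _ => Finset.sum_congr rfl fun θ' _ => ?_
  rw [covariance_const_mul_left, covariance_const_mul_right, covLogLik]
  ring

/-- This identity yields both the positive semidefiniteness of `cAve` and the match between the
Gaussian limit and the variance of the projections of `z_0`. -/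
theorem dotProduct_cAve_mulVec {N H : ℕ} {X : Fin N → Type*} [∀ k, MeasurableSpace (X k)]
    {ν : ∀ k, Measure (X k)} {L : ∀ k, Fin H → X k → ℝ} {θ₀ : Fin H} {π : Fin N → ℝ}
    [∀ k, IsProbabilityMeasure (law (ν k) (L k θ₀))]
    (h : ∀ k θ, θ ≠ θ₀ → MemLp (logLik (L k) θ₀ θ) 2 (law (ν k) (L k θ₀)))
    (t : EuclideanSpace ℝ {θ : Fin H // θ ≠ θ₀}) :
    t ⬝ᵥ (cAve ν L θ₀ π).mulVec t
      = ∑ l, π l ^ 2 * Var[fun x => inner ℝ (logLikVec (L l) θ₀ x) t; law (ν l) (L l θ₀)] := by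
  simp_rw [fun l => variance_inner_logLikVec (h l) t, dotProduct, Matrix.mulVec, dotProduct, cAve,
    Matrix.of_apply, Finset.sum_mul, Finset.mul_sum]
  rw [Finset.sum_comm_cycle]
  refine Finset.sum_congr rfl fun l _ => Finset.sum_congr rfl fun θ _ =>
    Finset.sum_congr rfl fun θ' _ => by ring

theorem posSemidef_cAve {N H : ℕ} {X : Fin N → Type*} [∀ k, MeasurableSpace (X k)]
    {ν : ∀ k, Measure (X k)} {L : ∀ k, Fin H → X k → ℝ} {θ₀ : Fin H} {π : Fin N → ℝ}
    [∀ k, IsProbabilityMeasure (law (ν k) (L k θ₀))]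
    (h : ∀ k θ, θ ≠ θ₀ → MemLp (logLik (L k) θ₀ θ) 2 (law (ν k) (L k θ₀))) :
    (cAve ν L θ₀ π).PosSemidef := by
  refine Matrix.posSemidef_iff_dotProduct_mulVec.2 ⟨?_, fun t => ?_⟩
  · ext θ θ'
    simp [cAve, covLogLik, covariance_comm]
  · have := dotProduct_cAve_mulVec (π := π) h (WithLp.toLp 2 t)
    simp only [star_trivial]
    rw [this]
    exact Finset.sum_nonneg fun l _ => mul_nonneg (sq_nonneg _) (variance_nonneg _ _)

theorem charFun_multivariateGaussian_cAve {N H : ℕ} {X : Fin N → Type*}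
    [∀ k, MeasurableSpace (X k)] {ν : ∀ k, Measure (X k)} {L : ∀ k, Fin H → X k → ℝ}
    {θ₀ : Fin H} {π : Fin N → ℝ} [∀ k, IsProbabilityMeasure (law (ν k) (L k θ₀))]
    (h : ∀ k θ, θ ≠ θ₀ → MemLp (logLik (L k) θ₀ θ) 2 (law (ν k) (L k θ₀)))
    (t : EuclideanSpace ℝ {θ : Fin H // θ ≠ θ₀}) :
    charFun (multivariateGaussian 0 ((1 / 2 : ℝ) • cAve ν L θ₀ π)) t
      = ((Real.exp (-((∑ l, π l ^ 2 *
          Var[fun x => inner ℝ (logLikVec (L l) θ₀ x) t; law (ν l) (L l θ₀)]) / 4)) : ℝ) : ℂ) := by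
  rw [charFun_multivariateGaussian ((posSemidef_cAve h).smul (by norm_num)),
    ← dotProduct_cAve_mulVec h, Matrix.smul_mulVec, dotProduct_smul]
  simp only [inner_zero_right, Complex.ofReal_zero, zero_mul, zero_sub, smul_eq_mul]
  push_cast
  congr 1
  ring

/-! ### Replacing the powers of the matrix by the Perron weights -/

/-- The rescaled deviation of the exponentially weighted sum with converging weights `b l m → π l`
is the one with constant weights up to an explicit remainder. -/
theorem inv_sqrt_smul_sub_eq {ι E : Type*} [Fintype ι] [NormedAddCommGroup E] [NormedSpace ℝ E]
    [CompleteSpace E] {δ : ℝ} (hδ : δ ∈ Set.Ioo (0 : ℝ) 1) {b : ι → ℕ → ℝ} {y : ι → ℕ → E}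
    {π : ι → ℝ} {d : ι → E} (h1 : ∀ l, Summable fun m => ‖(1 - δ) ^ m • y l m‖)
    (h2 : ∀ l, Summable fun m => ‖(b l m - π l) • y l m‖) :
    (√δ)⁻¹ • ((∑ l, δ • ∑' m, ((1 - δ) ^ m * b l m) • y l m) - ∑ l, π l • d l)
        - √δ • ∑' m, (1 - δ) ^ m • ∑ l, π l • (y l m - d l)
      = √δ • ∑ l, ∑' m, (1 - δ) ^ m • (b l m - π l) • y l m := by
  have hq0 : 0 ≤ 1 - δ := by linarith [hδ.2]
  have hq1 : 1 - δ < 1 := by linarith [hδ.1]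
  have hU := fun l => (h1 l).of_norm.hasSum
  have hD : ∀ l, HasSum (fun m => (1 - δ) ^ m • (b l m - π l) • y l m)
      (∑' m, (1 - δ) ^ m • (b l m - π l) • y l m) := fun l => by
    refine (Summable.of_norm_bounded (h2 l) fun m => ?_).hasSum
    rw [norm_smul, Real.norm_eq_abs, abs_of_nonneg (pow_nonneg hq0 m)]
    exact mul_le_of_le_one_left (norm_nonneg _) (pow_le_one₀ hq0 hq1.le)
  set U := fun l => ∑' m, (1 - δ) ^ m • y l m
  set D := fun l => ∑' m, (1 - δ) ^ m • (b l m - π l) • y l m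
  have hB : ∀ l, ∑' m, ((1 - δ) ^ m * b l m) • y l m = D l + π l • U l := fun l => by
    refine HasSum.tsum_eq (((hD l).add ((hU l).const_smul (π l))).congr_fun fun m => ?_)
    module
  -- The total weight `δ⁻¹` turns the centering by `d l` inside the series into the centering of the
  -- whole steady state.
  have hgeo : HasSum (fun m => (1 - δ) ^ m) δ⁻¹ := by
    simpa using hasSum_geometric_of_lt_one hq0 hq1
  have hZ : ∑' m, (1 - δ) ^ m • ∑ l, π l • (y l m - d l)
      = ∑ l, π l • (U l - δ⁻¹ • d l) := by
    refine HasSum.tsum_eq ((hasSum_sum fun l _ =>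
      ((hU l).sub (hgeo.smul_const (d l))).const_smul (π l)).congr_fun fun m => ?_)
    rw [Finset.smul_sum]
    exact Finset.sum_congr rfl fun l _ => by module
  rw [hZ]
  simp_rw [hB, Finset.smul_sum]
  rw [← Finset.sum_sub_distrib, Finset.smul_sum, ← Finset.sum_sub_distrib]
  refine Finset.sum_congr rfl fun l _ => ?_
  have hs : √δ ≠ 0 := (Real.sqrt_pos.2 hδ.1).ne'
  have h3 : δ = √δ * √δ := (Real.mul_self_sqrt hδ.1.le).symm
  set r := √δ
  rw [h3, smul_sub, smul_smul, inv_mul_cancel_left₀ hs]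
  match_scalars <;> field_simp <;> ring

/-- The bound does not involve `q = 1 - δ`, so the prefactor `√δ` alone drives the remainder to `0`.
-/
theorem norm_sum_tsum_pow_smul_le {ι E : Type*} [Fintype ι] [NormedAddCommGroup E]
    [NormedSpace ℝ E] {q : ℝ} (hq0 : 0 ≤ q) (hq1 : q ≤ 1) {w : ι → ℕ → E}
    (hw : ∀ l, Summable fun m => ‖w l m‖) :
    ‖∑ l, ∑' m, q ^ m • w l m‖ ≤ ∑ l, ∑' m, ‖w l m‖ := by
  refine (norm_sum_le _ _).trans (Finset.sum_le_sum fun l _ => ?_)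
  refine tsum_of_norm_bounded (hw l).hasSum fun m => ?_
  rw [norm_smul, Real.norm_eq_abs, abs_of_nonneg (pow_nonneg hq0 m)]
  exact mul_le_of_le_one_left (norm_nonneg _) (pow_le_one₀ hq0 hq1)

theorem steadyLogBelief_eq {N H : ℕ} {X : Fin N → Type*} (A : Matrix (Fin N) (Fin N) ℝ)
    (L : ∀ k, Fin H → X k → ℝ) (θ₀ : Fin H) (δ : ℝ) (obs : ∀ k, ℕ → X k) (k : Fin N)
    (h : ∀ l, Summable fun m =>
      ((1 - δ) ^ m * (A ^ (m + 1)) l k) • logLikVec (L l) θ₀ (obs l m)) :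
    steadyLogBelief A L θ₀ δ obs k
      = ∑ l, δ • ∑' m, ((1 - δ) ^ m * (A ^ (m + 1)) l k) • logLikVec (L l) θ₀ (obs l m) := by
  ext θ
  have h1 : ∀ l, (∑' m, ((1 - δ) ^ m * (A ^ (m + 1)) l k) • logLikVec (L l) θ₀ (obs l m)) θ
      = ∑' m, steadyTerm A L θ₀ δ obs k θ.1 l m := fun l => by
    have := (EuclideanSpace.proj (𝕜 := ℝ) θ).map_tsum (h l)
    simpa [logLikVec, steadyTerm] using this
  simp [steadyLogBelief, h1]

end ASL

/-! ### The steady state and its asymptotic normality -/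

theorem theorem3
    -- network, combination matrix and Perron eigenvector
    {N H : ℕ} (A : Matrix (Fin N) (Fin N) ℝ)
    (hA_conn : A.IsIrreducible) (hA_aper : ASL.IsAperiodic A)
    (hA_stoch : ∀ k, ∑ l, A l k = 1)
    (π : Fin N → ℝ) (hπ_eig : A.mulVec π = π) (hπ_sum : ∑ l, π l = 1) (hπ_pos : ∀ l, 0 < π l)
    -- likelihoods: probability densities with respect to reference measures
    {X : Fin N → Type*} [∀ k, MeasurableSpace (X k)]
    (ν : ∀ k, Measure (X k)) [∀ k, SigmaFinite (ν k)]
    (L : ∀ k, Fin H → X k → ℝ)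
    (hL_meas : ∀ k θ, Measurable (L k θ)) (hL_nonneg : ∀ k θ ξ, 0 ≤ L k θ ξ)
    (hL_prob : ∀ k θ, IsProbabilityMeasure (ASL.law (ν k) (L k θ)))
    (θ₀ : Fin H)
    -- data: `ξ k i` is the datum of agent `k` at time `i + 1`
    {Ω : Type*} [MeasurableSpace Ω] (P : Measure Ω) [IsProbabilityMeasure P]
    (ξ : ∀ k, ℕ → Ω → X k) (hξ_meas : ∀ k i, Measurable (ξ k i))
    (hξ_law : ∀ k i, P.map (ξ k i) = ASL.law (ν k) (L k θ₀))
    (hξ_time : iIndepFun (fun (i : ℕ) (ω : Ω) (k : Fin N) => ξ k i ω) P)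
    (hξ_agents : ∀ i, iIndepFun (fun (k : Fin N) => ξ k i) P)
    -- positive initial beliefs
    (μ₀ : Ω → Fin N → Fin H → ℝ) (hμ₀_meas : Measurable μ₀)
    (hμ₀_pos : ∀ ω k θ, 0 < μ₀ ω k θ) (hμ₀_sum : ∀ ω k, ∑ θ, μ₀ ω k θ = 1)
    -- finiteness of the Kullback-Leibler divergences
    (h_kl : ∀ k θ, θ ≠ θ₀ →
      InformationTheory.klDiv (ASL.law (ν k) (L k θ₀)) (ASL.law (ν k) (L k θ)) ≠ ⊤)
    -- global identifiability
    (h_id : ∀ θ, θ ≠ θ₀ → ∃ k, 0 < ASL.meanLogLik (ν k) (L k) θ₀ θ)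
    -- finite variance of the log-likelihood ratios
    (h_var : ∀ k θ, θ ≠ θ₀ →
      MemLp (ASL.logLik (L k) θ₀ θ) 2 (ASL.law (ν k) (L k θ₀)))
    (k : Fin N) :
    -- the series that define the steady-state log-belief ratios converge almost surely
    (∀ δ ∈ Set.Ioo (0 : ℝ) 1, ∀ θ, θ ≠ θ₀ → ∀ l, ∀ᵐ ω ∂P,
      Summable (ASL.steadyTerm A L θ₀ δ (fun j i => ξ j i ω) k θ l)) ∧
    -- they are the steady state of the algorithm
    (∀ δ ∈ Set.Ioo (0 : ℝ) 1,
      TendstoInDistribution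
        (fun (i : ℕ) ω => ASL.logBelief A L θ₀ δ (μ₀ ω) (fun j i => ξ j i ω) k i) atTop
        (fun ω => ASL.steadyLogBelief A L θ₀ δ (fun j i => ξ j i ω) k)
        (fun _ => P) P) ∧
    -- asymptotic normality as the step-size `δ ∈ (0, 1)` tends to `0`
    TendstoInDistribution
      (fun (δ : Set.Ioo (0 : ℝ) 1) ω =>
        (√(δ : ℝ))⁻¹ • (ASL.steadyLogBelief A L θ₀ δ (fun j i => ξ j i ω) k
          - ASL.mAve ν L θ₀ π))
      (comap (fun δ : Set.Ioo (0 : ℝ) 1 => (δ : ℝ)) (𝓝 0))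
      id (fun _ => P)
      (multivariateGaussian 0 ((1 / 2 : ℝ) • ASL.cAve ν L θ₀ π)) := by
  have hprob : ∀ l, IsProbabilityMeasure (ASL.law (ν l) (L l θ₀)) := fun l => hL_prob l θ₀
  -- the data as an i.i.d. sequence of vectors indexed by the agents
  have hid : ∀ l m, IdentDistrib (ξ l m) (ξ l 0) P P := fun l m =>
    ⟨(hξ_meas l m).aemeasurable, (hξ_meas l 0).aemeasurable, by rw [hξ_law, hξ_law]⟩
  -- Independence across agents makes the joint law at each time the product of the marginals, which
  -- do not depend on time.
  have hVid : ∀ m, IdentDistrib (fun ω l => ξ l m ω) (fun ω l => ξ l 0 ω) P P := fun m =>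
    IdentDistrib.pi (fun l => hid l m) (hξ_agents m) (hξ_agents 0)
  have hgm : ∀ l, Measurable (ASL.logLikVec (L l) θ₀) := fun l =>
    ASL.measurable_logLikVec (hL_meas l) θ₀
  have hgv : ∀ l, Measurable fun v : ∀ l, X l => ASL.logLikVec (L l) θ₀ (v l) := fun l =>
    (hgm l).comp (measurable_pi_apply l)
  have hxm : ∀ l m, Measurable fun ω => ASL.logLikVec (L l) θ₀ (ξ l m ω) := fun l m =>
    (hgm l).comp (hξ_meas l m)
  have hxid : ∀ l m, IdentDistrib (fun ω => ASL.logLikVec (L l) θ₀ (ξ l m ω))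
      (fun ω => ASL.logLikVec (L l) θ₀ (ξ l 0 ω)) P P := fun l m => (hid l m).comp (hgm l)
  have hgL : ∀ l, MemLp (ASL.logLikVec (L l) θ₀) 2 (ASL.law (ν l) (L l θ₀)) := fun l =>
    ASL.memLp_logLikVec (h_var l)
  have hxL : ∀ l m, MemLp (fun ω => ASL.logLikVec (L l) θ₀ (ξ l m ω)) 2 P := fun l m => by
    have h := hgL l
    rw [← hξ_law l m] at h
    exact h.comp_of_map (hξ_meas l m).aemeasurable
  have hxint : ∀ l m, Integrable (fun ω => ASL.logLikVec (L l) θ₀ (ξ l m ω)) P := fun l m =>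
    (hxL l m).integrable (by norm_num)
  have hsumm : ∀ l (c : ℕ → ℝ), Summable c →
      ∀ᵐ ω ∂P, Summable fun m => ‖c m • ASL.logLikVec (L l) θ₀ (ξ l m ω)‖ := fun l c hc =>
    ASL.ae_summable_norm_smul (hxid l) (hxint l) hc
  have hgeo : ∀ δ ∈ Set.Ioo (0 : ℝ) 1, Summable fun m : ℕ => (1 - δ) ^ m := fun δ hδ =>
    summable_geometric_of_lt_one (by linarith [hδ.2]) (by linarith [hδ.1])
  have hcoef : ∀ δ ∈ Set.Ioo (0 : ℝ) 1, ∀ l,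
      Summable fun m : ℕ => (1 - δ) ^ m * (A ^ (m + 1)) l k := fun δ hδ l => by
    have hq : 0 ≤ 1 - δ := by linarith [hδ.2]
    refine (hgeo δ hδ).of_nonneg_of_le (fun m => mul_nonneg (pow_nonneg hq m)
      (Matrix.pow_apply_nonneg hA_conn.nonneg _ _ _)) fun m => ?_
    exact mul_le_of_le_one_right (pow_nonneg hq m)
      (ASL.pow_apply_le_one hA_conn.nonneg hA_stoch _ _ _)
  have hsteady : ∀ δ ∈ Set.Ioo (0 : ℝ) 1, ∀ᵐ ω ∂P, ∀ l, Summable fun m =>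
      ‖((1 - δ) ^ m * (A ^ (m + 1)) l k) • ASL.logLikVec (L l) θ₀ (ξ l m ω)‖ := fun δ hδ =>
    ae_all_iff.2 fun l => hsumm l _ (hcoef δ hδ l)
  have hsteady_meas : ∀ δ ∈ Set.Ioo (0 : ℝ) 1,
      AEMeasurable (fun ω => ASL.steadyLogBelief A L θ₀ δ (fun j i => ξ j i ω) k) P := by
    intro δ hδ
    refine AEMeasurable.congr (f := fun ω => ∑ l, δ • ∑' m,
      ((1 - δ) ^ m * (A ^ (m + 1)) l k) • ASL.logLikVec (L l) θ₀ (ξ l m ω)) ?_ ?_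
    · have h1 : ∀ l, Measurable fun ω => ∑' m,
          ((1 - δ) ^ m * (A ^ (m + 1)) l k) • ASL.logLikVec (L l) θ₀ (ξ l m ω) := fun l =>
        Measurable.tsum fun m => (hxm l m).const_smul ((1 - δ) ^ m * (A ^ (m + 1)) l k)
      have h2 : ∀ l, Measurable fun ω => δ • ∑' m,
          ((1 - δ) ^ m * (A ^ (m + 1)) l k) • ASL.logLikVec (L l) θ₀ (ξ l m ω) := fun l =>
        (h1 l).const_smul δ
      exact (Finset.measurable_fun_sum _ fun l _ => h2 l).aemeasurable
    · filter_upwards [hsteady δ hδ] with ω hω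
      exact (ASL.steadyLogBelief_eq A L θ₀ δ _ k fun l => (hω l).of_norm).symm
  refine ⟨fun δ hδ θ hθ l => ?_, fun δ hδ => ?_, ?_⟩
  · filter_upwards [hsteady δ hδ] with ω hω
    refine Summable.of_norm_bounded (hω l) fun m => ?_
    exact PiLp.norm_apply_le (p := 2)
      (((1 - δ) ^ m * (A ^ (m + 1)) l k) • ASL.logLikVec (L l) θ₀ (ξ l m ω)) ⟨θ, hθ⟩
  · -- the likelihoods of the observed data are almost surely positive
    have hpos : ∀ᵐ ω ∂P, ∀ l m θ, 0 < L l θ (ξ l m ω) := by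
      simp only [ae_all_iff]
      intro l m θ
      have h1 : ∀ᵐ x ∂(ASL.law (ν l) (L l θ₀)), 0 < L l θ x := by
        by_cases hθ : θ = θ₀
        · rw [hθ]
          exact ASL.ae_law_pos _ (hL_meas l θ₀)
        -- A finite divergence forces absolute continuity, so a set null for the law under `θ` is
        -- null for the law of the data.
        · exact (InformationTheory.klDiv_ne_top_iff.1 (h_kl l θ hθ)).1.ae_le
            (ASL.ae_law_pos (ν l) (hL_meas l θ))
      rw [← hξ_law l m] at h1
      exact ae_of_ae_map (hξ_meas l m).aemeasurable h1
    set f : ℕ → (∀ l, X l) → EuclideanSpace ℝ {θ : Fin H // θ ≠ θ₀} := fun m v =>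
      ∑ l, (δ * (1 - δ) ^ m * (A ^ (m + 1)) l k) • ASL.logLikVec (L l) θ₀ (v l) with hf
    have hfm : ∀ m, Measurable (f m) := fun m => Finset.measurable_fun_sum _ fun l _ =>
      (hgv l).const_smul (δ * (1 - δ) ^ m * (A ^ (m + 1)) l k)
    have hVm : ∀ m, Measurable fun ω l => ξ l m ω := fun m =>
      measurable_pi_lambda _ fun l => hξ_meas l m
    have hforward : TendstoInDistribution
        (fun (i : ℕ) ω => ∑ m ∈ Finset.range i, f m fun l => ξ l m ω) atTop
        (fun ω => ASL.steadyLogBelief A L θ₀ δ (fun j i => ξ j i ω) k) (fun _ => P) P := by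
      refine tendstoInDistribution_of_ae_tendsto (fun i => (Finset.measurable_fun_sum _ fun m _ =>
        (hfm m).comp (hVm m)).aemeasurable) (hsteady_meas δ hδ) ?_
      filter_upwards [hsteady δ hδ] with ω hω
      rw [ASL.steadyLogBelief_eq A L θ₀ δ _ k fun l => (hω l).of_norm]
      refine ((hasSum_sum fun l _ => (hω l).of_norm.hasSum.const_smul δ).congr_fun
        fun m => ?_).tendsto_sum_nat
      simp only [hf, smul_smul, mul_assoc]
    -- The algorithm gives the largest power of `1 - δ` to the oldest datum, so its sums need not
    -- converge almost surely; they only share the laws of the forward sums.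
    have hbackward := ASL.tendstoInDistribution_congr_identDistrib hforward fun i =>
      ASL.identDistrib_sum_reverse hξ_time hVid hfm i
    set y₀ : Fin N → Ω → EuclideanSpace ℝ {θ : Fin H // θ ≠ θ₀} := fun l ω =>
      WithLp.toLp 2 fun θ => Real.log (μ₀ ω l θ₀ / μ₀ ω l θ.1) with hy₀
    have hy₀m : ∀ l, Measurable (y₀ l) := fun l =>
      (WithLp.measurable_toLp 2 _).comp (measurable_pi_lambda _ fun θ => by
        have h1 : ∀ θ, Measurable fun ω => μ₀ ω l θ := fun θ =>
          (measurable_pi_apply θ).comp ((measurable_pi_apply l).comp hμ₀_meas)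
        exact Real.measurable_log.comp ((h1 θ₀).div (h1 θ.1)))
    have hRm : ∀ i : ℕ, Measurable fun ω => (1 - δ) ^ i • ∑ l, (A ^ i) l k • y₀ l ω := fun i =>
      (Finset.measurable_fun_sum _ fun l _ => (hy₀m l).const_smul ((A ^ i) l k)).const_smul ((1 - δ) ^ i)
    have hBm : ∀ i : ℕ, Measurable fun ω =>
        ∑ m ∈ Finset.range i, f m fun l => ξ l (i - 1 - m) ω := fun i =>
      Finset.measurable_fun_sum _ fun m _ => (hfm m).comp (hVm _)
    have hq0 : 0 ≤ 1 - δ := by linarith [hδ.2]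
    have hq1 : 1 - δ < 1 := by linarith [hδ.1]
    have hR0 : ∀ ω, Tendsto (fun i : ℕ => (1 - δ) ^ i • ∑ l, (A ^ i) l k • y₀ l ω) atTop
        (𝓝 0) := by
      intro ω
      refine squeeze_zero_norm (a := fun i => (1 - δ) ^ i * ∑ l, ‖y₀ l ω‖) (fun i => ?_) ?_
      · rw [norm_smul, Real.norm_eq_abs, abs_of_nonneg (pow_nonneg hq0 i)]
        refine mul_le_mul_of_nonneg_left ((norm_sum_le _ _).trans
          (Finset.sum_le_sum fun l _ => ?_)) (pow_nonneg hq0 i)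
        rw [norm_smul, Real.norm_eq_abs,
          abs_of_nonneg (Matrix.pow_apply_nonneg hA_conn.nonneg _ _ _)]
        exact mul_le_of_le_one_left (norm_nonneg _)
          (ASL.pow_apply_le_one hA_conn.nonneg hA_stoch _ _ _)
      · simpa using (tendsto_pow_atTop_nhds_zero_of_lt_one hq0 hq1).mul_const (∑ l, ‖y₀ l ω‖)
    -- Slutsky: the vanishing initial term does not affect the limit law.
    have hlim := tendstoInDistribution_of_tendstoInMeasure_sub
      (fun i ω => (1 - δ) ^ i • ∑ l, (A ^ i) l k • y₀ l ω
        + ∑ m ∈ Finset.range i, f m fun l => ξ l (i - 1 - m) ω) _ hbackward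
      (tendstoInMeasure_of_tendsto_ae
        (fun i => (((hRm i).add (hBm i)).sub (hBm i)).aestronglyMeasurable)
        (Eventually.of_forall fun ω => by simpa using hR0 ω))
      fun i => ((hRm i).add (hBm i)).aemeasurable
    refine hlim.congr (fun i => ?_) (ae_eq_refl _)
    filter_upwards [hpos] with ω hω
    exact (ASL.logBelief_eq A L δ (hμ₀_pos ω) (fun j i => ξ j i ω) hω θ₀ i k).symm
  · set d : Fin N → EuclideanSpace ℝ {θ : Fin H // θ ≠ θ₀} := fun l =>
      WithLp.toLp 2 fun θ => ASL.meanLogLik (ν l) (L l) θ₀ θ.1 with hd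
    have hdint : ∀ l m, ∫ ω, ASL.logLikVec (L l) θ₀ (ξ l m ω) ∂P = d l := fun l m => by
      have h := ASL.integral_logLikVec (h_var l)
      rw [← hξ_law l m,
        integral_map (hξ_meas l m).aemeasurable (hgm l).aestronglyMeasurable] at h
      exact h
    have hmAve : ASL.mAve ν L θ₀ π = ∑ l, π l • d l := by
      ext θ
      simp [ASL.mAve, hd]
    set h : (∀ l, X l) → EuclideanSpace ℝ {θ : Fin H // θ ≠ θ₀} := fun v =>
      ∑ l, π l • (ASL.logLikVec (L l) θ₀ (v l) - d l) with hh
    have hhm : Measurable h := Finset.measurable_fun_sum _ fun l _ =>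
      ((hgv l).sub_const (d l)).const_smul (π l)
    set z : ℕ → Ω → EuclideanSpace ℝ {θ : Fin H // θ ≠ θ₀} := fun m ω =>
      h fun l => ξ l m ω with hz
    have hzind : iIndepFun z P := hξ_time.comp (fun _ => h) fun _ => hhm
    have hzid : ∀ m, IdentDistrib (z m) (z 0) P P := fun m => (hVid m).comp hhm
    have hzL : MemLp (z 0) 2 P := memLp_finsetSum _ fun l _ =>
      ((hxL l 0).sub (memLp_const (d l))).const_smul (π l)
    have hz0 : ∫ ω, z 0 ω ∂P = 0 := by
      simp only [hz, hh]
      have hi : ∀ l, Integrable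
          (fun ω => π l • (ASL.logLikVec (L l) θ₀ (ξ l 0 ω) - d l)) P := fun l =>
        ((hxint l 0).sub (integrable_const (d l))).smul (π l)
      rw [integral_finsetSum _ fun l _ => hi l]
      refine Finset.sum_eq_zero fun l _ => ?_
      rw [integral_smul, integral_sub (hxint l 0) (integrable_const _), hdint]
      simp
    have hzvar : ∀ t, Var[fun ω => inner ℝ (z 0 ω) t; P] = ∑ l, π l ^ 2 *
        Var[fun x => inner ℝ (ASL.logLikVec (L l) θ₀ x) t; ASL.law (ν l) (L l θ₀)] := by
      intro t
      have him : ∀ l, Measurable fun x => inner ℝ (ASL.logLikVec (L l) θ₀ x) t := fun l =>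
        (hgm l).inner measurable_const
      have h1 : (fun ω => inner ℝ (z 0 ω) t) = ∑ l, fun ω =>
          π l * (inner ℝ (ASL.logLikVec (L l) θ₀ (ξ l 0 ω)) t - inner ℝ (d l) t) := by
        ext ω
        simp [hz, hh, sum_inner, inner_smul_left, inner_sub_left]
      have h2 : ∀ l, MemLp (fun ω => inner ℝ (ASL.logLikVec (L l) θ₀ (ξ l 0 ω)) t) 2 P :=
        fun l => by simpa only [real_inner_comm] using (hxL l 0).const_inner t
      have h3 : ∀ l, MemLp (fun ω =>
          π l * (inner ℝ (ASL.logLikVec (L l) θ₀ (ξ l 0 ω)) t - inner ℝ (d l) t)) 2 P :=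
        fun l => ((h2 l).sub (memLp_const (inner ℝ (d l) t))).const_mul (π l)
      rw [h1, IndepFun.variance_sum fun l _ => h3 l]
      · refine Finset.sum_congr rfl fun l _ => ?_
        rw [variance_const_mul, variance_sub_const (h2 l).1, ← hξ_law l 0,
          variance_map (him l).aemeasurable (hξ_meas l 0).aemeasurable]
        rfl
      -- Distinct agents are independent, hence no cross terms and the weights `π l ^ 2`.
      · intro l _ l' _ hll
        exact ((hξ_agents 0).indepFun hll).comp
          (φ := fun x => π l * (inner ℝ (ASL.logLikVec (L l) θ₀ x) t - inner ℝ (d l) t))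
          (ψ := fun x => π l' * (inner ℝ (ASL.logLikVec (L l') θ₀ x) t - inner ℝ (d l') t))
          (((him l).sub_const (inner ℝ (d l) t)).const_mul (π l))
          (((him l').sub_const (inner ℝ (d l') t)).const_mul (π l'))
    have hperron := ASL.summable_abs_pow_sub (ASL.isPrimitive_of_isAperiodic hA_conn hA_aper)
      hA_stoch hπ_eig hπ_sum
    have hYm : ∀ δ ∈ Set.Ioo (0 : ℝ) 1, AEMeasurable (fun ω => (√δ)⁻¹ •
        (ASL.steadyLogBelief A L θ₀ δ (fun j i => ξ j i ω) k - ASL.mAve ν L θ₀ π)) P :=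
      fun δ hδ => ((hsteady_meas δ hδ).sub_const (ASL.mAve ν L θ₀ π)).const_smul (√δ)⁻¹
    -- convergence along sequences of step-sizes
    have hseq : ∀ u : ℕ → Set.Ioo (0 : ℝ) 1, Tendsto (fun n => (u n : ℝ)) atTop (𝓝 0) →
        TendstoInDistribution (fun n ω => (√(u n : ℝ))⁻¹ •
          (ASL.steadyLogBelief A L θ₀ (u n) (fun j i => ξ j i ω) k - ASL.mAve ν L θ₀ π)) atTop
          id (fun _ => P) (multivariateGaussian 0 ((1 / 2 : ℝ) • ASL.cAve ν L θ₀ π)) := by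
      intro u hu
      have hT := ASL.tendstoInDistribution_sqrt_smul_tsum hzind hzid hzL hz0
        (G := multivariateGaussian 0 ((1 / 2 : ℝ) • ASL.cAve ν L θ₀ π))
        (fun t => by rw [hzvar]; exact ASL.charFun_multivariateGaussian_cAve h_var t)
        (δ := fun n => (u n : ℝ)) (fun n => (u n).2) hu
      refine tendstoInDistribution_of_tendstoInMeasure_sub _ _ hT
        (tendstoInMeasure_of_tendsto_ae (fun n =>
          ((hYm _ (u n).2).sub (hT.forall_aemeasurable n)).aestronglyMeasurable) ?_)
        fun n => hYm _ (u n).2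
      -- The exceptional null sets depend on the step-size; along a sequence they are countably
      -- many.
      filter_upwards [ae_all_iff.2 fun n => hsteady _ (u n).2,
        ae_all_iff.2 fun n => ae_all_iff.2 fun l => hsumm l _ (hgeo _ (u n).2),
        ae_all_iff.2 fun l => hsumm l _ (hperron l k).of_abs] with ω hω1 hω2 hω3
      have heq : ∀ n, (√(u n : ℝ))⁻¹ •
          (ASL.steadyLogBelief A L θ₀ (u n) (fun j i => ξ j i ω) k - ASL.mAve ν L θ₀ π)
            - √(u n : ℝ) • ∑' m, (1 - (u n : ℝ)) ^ m • z m ω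
          = √(u n : ℝ) • ∑ l, ∑' m, (1 - (u n : ℝ)) ^ m • ((A ^ (m + 1)) l k - π l) •
            ASL.logLikVec (L l) θ₀ (ξ l m ω) := fun n => by
        rw [ASL.steadyLogBelief_eq A L θ₀ _ _ k fun l => (hω1 n l).of_norm, hmAve]
        exact ASL.inv_sqrt_smul_sub_eq (u n).2 (hω2 n) hω3
      simp only [Pi.sub_apply, Pi.zero_apply]
      simp_rw [heq]
      refine squeeze_zero_norm (a := fun n => √(u n : ℝ) * ∑ l, ∑' m,
        ‖((A ^ (m + 1)) l k - π l) • ASL.logLikVec (L l) θ₀ (ξ l m ω)‖) (fun n => ?_) ?_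
      · rw [norm_smul, Real.norm_eq_abs, abs_of_nonneg (Real.sqrt_nonneg _)]
        exact mul_le_mul_of_nonneg_left (ASL.norm_sum_tsum_pow_smul_le
          (by linarith [(u n).2.2]) (by linarith [(u n).2.1]) hω3) (Real.sqrt_nonneg _)
      · have h1 := (Real.continuous_sqrt.tendsto 0).comp hu
        rw [Real.sqrt_zero] at h1
        simpa using h1.mul_const (∑ l, ∑' m,
          ‖((A ^ (m + 1)) l k - π l) • ASL.logLikVec (L l) θ₀ (ξ l m ω)‖)
    -- The filter on step-sizes is countably generated, so sequences determine the limit.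
    exact
      { forall_aemeasurable := fun δ => hYm δ δ.2
        aemeasurable_limit := aemeasurable_id
        tendsto := tendsto_of_seq_tendsto fun u hu => (hseq u (tendsto_comap_iff.1 hu)).tendsto }
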